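/- An inversion sequence of length $n\ge 0$ is an integer sequence $(a_1,\dots,a_n)$ with $0\le a_i<i$ for all $i$. It contains a pattern $\sigma=\sigma_1\sigma_2\sigma_3$ if for some $i<j<k$ the entries $a_i,a_j,a_k$ are in the same relative order (equalities included) as $\sigma_1,\sigma_2,\sigma_3$; otherwise it avoids $\sigma$. Let $\mathcal I_n(-,\neq,\geq)$ be the set of inversion sequences of length $n$ for which there are no $i<j<k$ with $a_j\neq a_k$ and $a_i\geq a_k$. **Theorem.** For every $n$, $\mathcal I_n(-,\neq,\geq)$ is the set of inversion sequences of length $n$ that avoid all of the patterns $010,101,110,120,201,210$. Let $A(z)=\sum_{n\ge 0}|\mathcal I_n(-,\neq,\geq)|\,z^n$, and let $K$ be a field of characteristic $0$ (for instance $\mathbb Q$ or $\mathbb C$). There is exactly one formal power series $X=X(z)\in K[[z]]$ with $$1-X-zX+2zX^2+z^2X-z^2X^3=0,$$ and, in the field $K((z))$ of formal Laurent series, $$A(z)=\frac{(X-1)(1-zX+z^2X)}{zX}.$$ Moreover $$A(z)=1+z+2z^2+5z^3+15z^4+50z^5+178z^6+663z^7+2552z^8+\cdots,$$ and $A(z)$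 is algebraic of degree $3$ over $K(z)$: up to the sign that makes it monic, its minimal polynomial over $K(z)$, in the indeterminate $T$, is $$1-(4-z)T+2(2-z)T^2-T^3.$$ -/

import Mathlib

-- makes the field `K((z))` of formal Laurent series an algebra over `K(z)` in the canonical way
open scoped RatFunc

/-- The inversion sequences of length `n`. The one-based condition `0 ≤ a_i < i` for
`1 ≤ i ≤ n` reads `a i ≤ i` for the zero-based positions `i : Fin n`. -/
def inversionSequences (n : ℕ) : Set (Fin n → ℕ) :=
  {a | ∀ i : Fin n, a i < (i : ℕ) + 1}

/-- There are finitely many inversion sequences of each length, so that `Set.ncard` really counts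
the elements of any subset of `inversionSequences n`. -/
theorem inversionSequences_finite (n : ℕ) : (inversionSequences n).Finite :=
  (Set.finite_Iic (fun i : Fin n => (i : ℕ))).subset
    (fun _ ha i => Nat.le_of_lt_succ (ha i))

/-- The reduction (standardisation) of a finite sequence of natural numbers: its smallest entries
are replaced by `0`, the next-smallest ones by `1`, and so on; that is, each entry is replaced by
the number of distinct values of the sequence that are smaller than it. -/
def reduction {k : ℕ} (w : Fin k → ℕ) : Fin k → ℕ :=
  fun i => ((Finset.univ.image w).filter (fun v => v < w i)).card

/-- `a` contains the pattern `σ`: some (not necessarily consecutive) subsequence of `a` has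
reduction `σ`. -/
def ContainsPattern {n k : ℕ} (a : Fin n → ℕ) (σ : Fin k → ℕ) : Prop :=
  ∃ p : Fin k → Fin n, StrictMono p ∧ reduction (fun i => a (p i)) = σ

/-- `𝓘ₙ(S)`: the inversion sequences of length `n` that avoid all patterns in `S`. -/
def patternAvoiders {k : ℕ} (S : Set (Fin k → ℕ)) (n : ℕ) : Set (Fin n → ℕ) :=
  {a | a ∈ inversionSequences n ∧ ∀ σ ∈ S, ¬ ContainsPattern a σ}

/-- `𝓘ₙ(ρ₁, ρ₂, ρ₃)`: the inversion sequences `a` of length `n` such that there are no positions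
`i < j < k` with `a_i ρ₁ a_j`, `a_j ρ₂ a_k` and `a_i ρ₃ a_k`. -/
def relationAvoiders (ρ₁ ρ₂ ρ₃ : ℕ → ℕ → Prop) (n : ℕ) : Set (Fin n → ℕ) :=
  {a | a ∈ inversionSequences n ∧
    ¬ ∃ i j k : Fin n, i < j ∧ j < k ∧ ρ₁ (a i) (a j) ∧ ρ₂ (a j) (a k) ∧ ρ₃ (a i) (a k)}

/-- The relation `-`, which holds between any two numbers. -/
def noRestriction : ℕ → ℕ → Prop := fun _ _ => True

/-- `𝓘ₙ(-, ≠, ≥)`. -/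
def class663A (n : ℕ) : Set (Fin n → ℕ) :=
  relationAvoiders noRestriction (fun x y => x ≠ y) (fun x y => x ≥ y) n

/-- The patterns 010, 101, 110, 120, 201, 210. -/
def patterns663A : Set (Fin 3 → ℕ) :=
  {![0, 1, 0], ![1, 0, 1], ![1, 1, 0], ![1, 2, 0], ![2, 0, 1], ![2, 1, 0]}

/-- The ordinary generating function `∑ₙ |𝓘ₙ(-, ≠, ≥)| zⁿ`, over a coefficient ring `K`. -/
noncomputable def genFun663A (K : Type*) [Semiring K] : PowerSeries K :=
  PowerSeries.mk (fun n => ((class663A n).ncard : K))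

/-- The kernel `1 - x - z x + 2 z x² + z² x - z² x³`, evaluated at a power series `x` in `z`. -/
noncomputable def kernel663A {K : Type*} [CommRing K] (x : PowerSeries K) : PowerSeries K :=
  let z : PowerSeries K := PowerSeries.X
  1 - x - z * x + 2 * z * x ^ 2 + z ^ 2 * x - z ^ 2 * x ^ 3

/-- The polynomial `1 - (4 - z) A + 2 (2 - z) A² - A³` in the indeterminate `A` over the field
`K(z)` of rational functions. -/
noncomputable def cubic663A (K : Type*) [Field K] : Polynomial (RatFunc K) :=
  let z : RatFunc K := RatFunc.X
  let A : Polynomial (RatFunc K) := Polynomial.X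
  1 - Polynomial.C (4 - z) * A + Polynomial.C (2 * (2 - z)) * A ^ 2 - A ^ 3

/-- The same generating function, regarded as a formal Laurent series in `z`. -/
noncomputable def genFunLaurent663A (K : Type*) [Semiring K] : LaurentSeries K :=
  (genFun663A K : LaurentSeries K)

/-! ### The class as a class of pattern avoiders -/

/-! The six patterns are the order types of triples whose last two entries differ and whose first is
at least the last, so the two descriptions of the class agree.

For the count, sequences grow on the right, and only two kinds of state occur. After a new strict
maximum `l`, every value above the previous maximum may follow. After any other entry `c`, either
`c` is repeated or the maximum is exceeded. If `l` exceeds the previous maximum by `q + 1`, the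
first kind offers `q` more non-records than the second, so both are counted by one array `contCount`
(`extensionCount_eq`). Second differences turn its definition into a linear recurrence with constant
coefficients (`contCount_recurrence`).

Let `C p` be the generating functions of this array in the number of appended entries, so that `C 0`
is the series sought. They satisfy a recurrence in `p` whose characteristic cubic has roots `λ` with
`1/(zλ)` a root of the kernel. Writing the root to be discarded as `1/(z t)`, with `t` the power
series root of the kernel, leaves a second-order recurrence that can be solved explicitly
(`genFun663A_mul_eq`). Eliminating `t` gives the cubic, which is irreducible because it has no root
in `K(z)`. -/

theorem reduction_lt_reduction {k : ℕ} {w : Fin k → ℕ} {i j : Fin k} (h : w i < w j) :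
    reduction w i < reduction w j := by
  refine Finset.card_lt_card (Finset.ssubset_iff_of_subset ?_ |>.2 ⟨w i, ?_, ?_⟩)
  · intro v hv
    simp only [Finset.mem_filter] at hv ⊢
    exact ⟨hv.1, hv.2.trans h⟩
  · simp [h]
  · simp

theorem reduction_lt_reduction_iff {k : ℕ} {w : Fin k → ℕ} {i j : Fin k} :
    reduction w i < reduction w j ↔ w i < w j := by
  refine ⟨fun h => ?_, reduction_lt_reduction⟩
  by_contra hij
  rcases (not_lt.1 hij).lt_or_eq with h' | h'
  · exact (reduction_lt_reduction h').not_gt h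
  · simp [reduction, h'] at h

theorem reduction_three_mem_patterns663A {w : Fin 3 → ℕ} (hne : w 1 ≠ w 2) (hge : w 2 ≤ w 0) :
    reduction w ∈ patterns663A := by
  obtain ⟨x, y, v, rfl⟩ : ∃ x y v, w = ![x, y, v] :=
    ⟨w 0, w 1, w 2, by ext i; fin_cases i <;> rfl⟩
  simp only [Matrix.cons_val] at hne hge
  have key : ∀ a b c : ℕ, ((({x, y, v} : Finset ℕ).filter (· < x)).card = a ∧
      (({x, y, v} : Finset ℕ).filter (· < y)).card = b ∧
      (({x, y, v} : Finset ℕ).filter (· < v)).card = c) →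
      reduction ![x, y, v] = ![a, b, c] := by
    rintro a b c ⟨rfl, rfl, rfl⟩
    have himage : Finset.univ.image ![x, y, v] = {x, y, v} := by
      ext u
      simp [Fin.exists_fin_succ, eq_comm]
    ext i
    simp only [reduction, himage]
    fin_cases i <;> rfl
  simp only [patterns663A, Set.mem_insert_iff, Set.mem_singleton_iff]
  rcases hge.eq_or_lt with rfl | h
  · rcases hne.lt_or_gt with h' | h'
    · exact Or.inr <| Or.inl <| key _ _ _ (by
        simp [Finset.filter_insert, Finset.filter_singleton, h', h'.not_gt])
    · exact Or.inl <| key _ _ _ (by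
        simp [Finset.filter_insert, Finset.filter_singleton, h', h'.not_gt])
  · rcases lt_trichotomy x y with h' | rfl | h'
    · exact Or.inr <| Or.inr <| Or.inr <| Or.inl <| key _ _ _ (by
        simp [Finset.filter_insert, Finset.filter_singleton, h, h', h'.not_gt, h.not_gt,
          h.trans h', (h.trans h').not_gt, h.ne'])
    · exact Or.inr <| Or.inr <| Or.inl <| key _ _ _ (by
        simp [Finset.filter_insert, Finset.filter_singleton, h, h.not_gt])
    · rcases hne.lt_or_gt with h'' | h''
      · exact Or.inr <| Or.inr <| Or.inr <| Or.inr <| Or.inl <| key _ _ _ (by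
          simp [Finset.filter_insert, Finset.filter_singleton, h, h', h'.not_gt, h.not_gt,
            h'', h''.not_gt, h''.ne])
      · exact Or.inr <| Or.inr <| Or.inr <| Or.inr <| Or.inr <| key _ _ _ (by
          simp [Finset.filter_insert, Finset.filter_singleton, h, h', h'.not_gt, h.not_gt,
            h'', h''.not_gt, h''.ne'])

theorem class663A_eq_patternAvoiders (n : ℕ) :
    class663A n = patternAvoiders patterns663A n := by
  ext a
  simp only [class663A, relationAvoiders, patternAvoiders, Set.mem_ofPred_eq, noRestriction,
    true_and]
  refine and_congr_right fun _ => ⟨?_, ?_⟩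
  · rintro h σ hσ ⟨p, hp, hr⟩
    refine h ⟨p 0, p 1, p 2, hp (by decide), hp (by decide), ?_⟩
    have h12 := @reduction_lt_reduction_iff _ (fun i => a (p i)) 1 2
    have h21 := @reduction_lt_reduction_iff _ (fun i => a (p i)) 2 1
    have h02 := @reduction_lt_reduction_iff _ (fun i => a (p i)) 0 2
    rw [hr] at h12 h21 h02
    simp only [patterns663A, Set.mem_insert_iff, Set.mem_singleton_iff] at hσ
    rcases hσ with rfl | rfl | rfl | rfl | rfl | rfl <;> simp at h12 h21 h02 <;> omega
  · rintro h ⟨i, j, k, hij, hjk, hne, hge⟩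
    refine h _ (reduction_three_mem_patterns663A (w := fun t => a (![i, j, k] t)) hne hge)
      ⟨![i, j, k], ?_, rfl⟩
    rw [Fin.strictMono_iff_lt_succ]
    intro t
    fin_cases t
    · exact hij
    · exact hjk

/-! ### Counting by appending entries -/

/-- The value `v` may be appended to the sequence `a` without creating a forbidden triple. -/
def Appendable {m : ℕ} (a : Fin m → ℕ) (v : ℕ) : Prop :=
  ∀ i j : Fin m, i < j → a j ≠ v → a i < v

/-- The only new conditions come from triples with `u` in the middle. -/
theorem appendable_snoc {m : ℕ} (a : Fin m → ℕ) (u v : ℕ) :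
    Appendable (Fin.snoc a u : Fin (m + 1) → ℕ) v ↔
      Appendable a v ∧ (v = u ∨ ∀ i, a i < v) := by
  constructor
  · intro h
    refine ⟨fun i j hij hj => ?_, or_iff_not_imp_left.2 fun huv i => ?_⟩
    · simpa using h i.castSucc j.castSucc hij (by simpa using hj)
    · simpa using h i.castSucc (Fin.last m) i.castSucc_lt_last (by simpa using Ne.symm huv)
  · rintro ⟨h, h'⟩ i j hij hj
    cases j using Fin.lastCases with
    | last =>
      cases i using Fin.lastCases with
      | last => exact absurd hij (lt_irrefl _)
      | cast i =>
        have : v ≠ u := fun e => hj (by simp [e])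
        simpa using h'.resolve_left this i
    | cast j =>
      cases i using Fin.lastCases with
      | last => exact absurd hij (Fin.castSucc_lt_last j).not_gt
      | cast i => simpa using h i j hij (by simpa using hj)

theorem forall_snoc_lt {m : ℕ} (a : Fin m → ℕ) (u v : ℕ) :
    (∀ i, (Fin.snoc a u : Fin (m + 1) → ℕ) i < v) ↔ (∀ i, a i < v) ∧ u < v := by
  simp [Fin.forall_fin_succ']

theorem snoc_mem_class663A {m : ℕ} (a : Fin m → ℕ) (v : ℕ) :
    (Fin.snoc a v : Fin (m + 1) → ℕ) ∈ class663A (m + 1) ↔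
      a ∈ class663A m ∧ v < m + 1 ∧ Appendable a v := by
  simp only [class663A, relationAvoiders, inversionSequences, Set.mem_ofPred_eq, noRestriction,
    true_and, Fin.forall_fin_succ', Fin.snoc_castSucc, Fin.snoc_last, Fin.val_castSucc,
    Fin.val_last, not_exists, not_and, Appendable, Fin.castSucc_lt_castSucc_iff,
    Fin.castSucc_lt_last, (Fin.le_last _).not_gt, false_imp_iff, forall_const, and_true,
    ge_iff_le, not_le, forall_and]
  tauto

open Classical in
/-- The number of ways to append `n` entries to `a` one by one, each of them appendable. -/
noncomputable def extensionCount : ℕ → (m : ℕ) → (Fin m → ℕ) → ℕ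
  | 0, _, _ => 1
  | n + 1, m, a => ∑ v ∈ (Finset.range (m + 1)).filter (Appendable a),
      extensionCount n (m + 1) (Fin.snoc a v)

theorem class663A_finite (n : ℕ) : (class663A n).Finite :=
  (inversionSequences_finite n).subset fun _ h => h.1

theorem sum_extensionCount (n m : ℕ) :
    ∑ a ∈ (class663A_finite m).toFinset, extensionCount n m a = (class663A (m + n)).ncard := by
  classical
  induction n generalizing m with
  | zero =>
    simp [extensionCount, Set.ncard_eq_toFinset_card _ (class663A_finite m)]
  | succ n ih =>
    rw [show m + (n + 1) = m + 1 + n by ring, ← ih]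
    simp only [extensionCount]
    rw [Finset.sum_sigma']
    refine Finset.sum_bij' (fun x _ => (Fin.snoc x.1 x.2 : Fin (m + 1) → ℕ))
      (fun b _ => ⟨Fin.init b, b (Fin.last m)⟩) ?_ ?_ ?_ ?_ ?_
    · rintro ⟨a, v⟩ h
      simp only [Finset.mem_sigma, Finset.mem_filter, Finset.mem_range,
        Set.Finite.mem_toFinset] at h ⊢
      exact (snoc_mem_class663A a v).2 h
    · intro b h
      simp only [Finset.mem_sigma, Finset.mem_filter, Finset.mem_range,
        Set.Finite.mem_toFinset] at h ⊢
      rw [← Fin.snoc_init_self b] at h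
      exact (snoc_mem_class663A _ _).1 h
    · rintro ⟨a, v⟩ h
      simp
    · intro b h
      simp
    · rintro ⟨a, v⟩ h
      rfl

theorem ncard_class663A (n : ℕ) :
    (class663A n).ncard = extensionCount n 0 Fin.elim0 := by
  have h : (class663A_finite 0).toFinset = {Fin.elim0} := by
    refine Finset.eq_singleton_iff_unique_mem.2 ⟨?_, fun a _ => Subsingleton.elim _ _⟩
    exact (class663A_finite 0).mem_toFinset.2 ⟨fun i => i.elim0, fun ⟨i, _⟩ => i.elim0⟩
  have := sum_extensionCount n 0
  rw [h, Finset.sum_singleton, zero_add] at this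
  exact this.symm

open Finset in
/-- `contCount (n + 1) p` is the number of ways to append `n` entries to a sequence of which some
value may be repeated, and to which besides exactly `p` values above its maximum may be
appended. -/
def contCount : ℕ → ℕ → ℕ
  | 0, _ => 0
  | 1, _ => 1
  | n + 2, p => contCount (n + 1) (p + 1) +
      ∑ i ∈ range p, (contCount (n + 1) (p - i) + i * contCount n (p - i + 1))

/-- The sequence ends in a strict maximum `l`, and every value from `M` on is appendable. -/
structure EndsInRecord {m : ℕ} (a : Fin m → ℕ) (M l : ℕ) : Prop where
  lt_iff : ∀ v, (∀ i, a i < v) ↔ l < v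
  appendable_iff : ∀ v, Appendable a v ↔ M ≤ v

/-- The values from `w` on exceed all entries; besides these only `c` is appendable. -/
structure EndsInRun {m : ℕ} (a : Fin m → ℕ) (w c : ℕ) : Prop where
  lt_iff : ∀ v, (∀ i, a i < v) ↔ w ≤ v
  appendable_iff : ∀ v, Appendable a v ↔ v = c ∨ w ≤ v

/-! ### Transitions between the two kinds of state -/

section

variable {m : ℕ} {a : Fin m → ℕ}

theorem EndsInRecord.snoc_gt {M l u : ℕ} (h : EndsInRecord a M l) (hM : M ≤ l) (hu : l < u) :
    EndsInRecord (Fin.snoc a u : Fin (m + 1) → ℕ) (l + 1) u where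
  lt_iff v := by rw [forall_snoc_lt, h.lt_iff]; omega
  appendable_iff v := by rw [appendable_snoc, h.lt_iff, h.appendable_iff]; omega

theorem EndsInRecord.snoc_le {M l u : ℕ} (h : EndsInRecord a M l) (hM : M ≤ u) (hu : u ≤ l) :
    EndsInRun (Fin.snoc a u : Fin (m + 1) → ℕ) (l + 1) u where
  lt_iff v := by rw [forall_snoc_lt, h.lt_iff]; omega
  appendable_iff v := by rw [appendable_snoc, h.lt_iff, h.appendable_iff]; omega

theorem EndsInRun.snoc_ge {w c u : ℕ} (h : EndsInRun a w c) (hu : w ≤ u) :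
    EndsInRecord (Fin.snoc a u : Fin (m + 1) → ℕ) w u where
  lt_iff v := by rw [forall_snoc_lt, h.lt_iff]; omega
  appendable_iff v := by rw [appendable_snoc, h.lt_iff, h.appendable_iff]; omega

theorem EndsInRun.snoc_self {w c : ℕ} (h : EndsInRun a w c) (hc : c < w) :
    EndsInRun (Fin.snoc a c : Fin (m + 1) → ℕ) w c where
  lt_iff v := by rw [forall_snoc_lt, h.lt_iff]; omega
  appendable_iff v := by rw [appendable_snoc, h.lt_iff, h.appendable_iff]; omega

end

/-- A record state has `q + 1` non-record continuations, all equivalent to the single repetition in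
a run state with the same `p`; the record continuations are the same in both. Hence the surplus `q *
contCount n (p + 1)`, which vanishes for `n = 0` because `contCount 0` is `0`. -/
theorem extensionCount_eq (n : ℕ) :
    (∀ (m : ℕ) (a : Fin m → ℕ) (M p q : ℕ), EndsInRecord a M (M + q) → m = M + q + p →
      extensionCount n m a = contCount (n + 1) p + q * contCount n (p + 1)) ∧
    ∀ (m : ℕ) (a : Fin m → ℕ) (w c p : ℕ), EndsInRun a w c → c < w → m + 1 = w + p →
      extensionCount n m a = contCount (n + 1) p := by
  classical
  induction n with
  | zero => simp [extensionCount, contCount]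
  | succ n ih =>
    obtain ⟨ihA, ihB⟩ := ih
    constructor
    · intro m a M p q h hm
      have hset : (Finset.range (m + 1)).filter (Appendable a) = Finset.Ico M (M + (q + 1 + p)) := by
        ext v
        simp only [Finset.mem_filter, Finset.mem_range, Finset.mem_Ico, h.appendable_iff]
        omega
      rw [extensionCount, hset, Finset.sum_Ico_eq_sum_range, Nat.add_sub_cancel_left,
        Finset.sum_range_add]
      have h1 : ∀ i ∈ Finset.range (q + 1),
          extensionCount n (m + 1) (Fin.snoc a (M + i)) = contCount (n + 1) (p + 1) := by
        intro i hi
        rw [Finset.mem_range] at hi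
        exact ihB _ _ (M + q + 1) _ _ (h.snoc_le (by omega) (by omega)) (by omega) (by omega)
      have h2 : ∀ i ∈ Finset.range p,
          extensionCount n (m + 1) (Fin.snoc a (M + (q + 1 + i))) =
            contCount (n + 1) (p - i) + i * contCount n (p - i + 1) := by
        intro i hi
        rw [Finset.mem_range] at hi
        refine ihA _ _ (M + q + 1) _ _ ?_ (by omega)
        rw [show M + (q + 1 + i) = M + q + 1 + i by ring]
        exact h.snoc_gt (by omega) (by omega)
      rw [Finset.sum_congr rfl h1, Finset.sum_congr rfl h2, contCount]
      simp
      ring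
    · intro m a w c p h hc hm
      have hset : (Finset.range (m + 1)).filter (Appendable a) =
          insert c (Finset.Ico w (w + p)) := by
        ext v
        simp only [Finset.mem_filter, Finset.mem_range, Finset.mem_Ico, h.appendable_iff,
          Finset.mem_insert]
        omega
      rw [extensionCount, hset, Finset.sum_insert (by simp [hc]),
        Finset.sum_Ico_eq_sum_range, Nat.add_sub_cancel_left,
        ihB _ _ w c (p + 1) (h.snoc_self hc) hc (by omega), contCount]
      congr 1
      refine Finset.sum_congr rfl fun i hi => ?_
      rw [Finset.mem_range] at hi
      exact ihA _ _ w _ _ (h.snoc_ge (by omega)) (by omega)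

theorem contCount_zero_right (n : ℕ) : contCount (n + 2) 0 = contCount (n + 1) 1 := by
  simp [contCount]

theorem ncard_class663A_eq_contCount (n : ℕ) : (class663A n).ncard = contCount (n + 1) 0 := by
  classical
  rw [ncard_class663A]
  cases n with
  | zero => rfl
  | succ n =>
    -- The first entry must be `0`; it is a record with `q = 0`, and `1` is the only larger value
    -- allowed next, so `p = 1`.
    have h : EndsInRecord (Fin.snoc Fin.elim0 0 : Fin (0 + 1) → ℕ) 0 (0 + 0) := by
      constructor
      · intro v
        rw [forall_snoc_lt]
        simp
      · intro v
        rw [appendable_snoc]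
        simp [Appendable]
    have hset : (Finset.range (0 + 1)).filter (Appendable (Fin.elim0 : Fin 0 → ℕ)) = {0} := by
      ext v
      simp [Appendable]
    rw [extensionCount, hset, Finset.sum_singleton,
      (extensionCount_eq n).1 _ _ 0 1 0 h (by norm_num), contCount_zero_right]
    ring

theorem contCount_one_right (n : ℕ) :
    contCount (n + 2) 1 = contCount (n + 2) 0 + contCount (n + 1) 2 := by
  simp [contCount]
  ring

/-- The first difference in `p` removes the weight `i` from the convolution, the second removes the
sum itself. -/
theorem contCount_recurrence (n p : ℕ) :
    contCount (n + 2) (p + 2) + contCount (n + 2) p + contCount (n + 1) (p + 2) =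
      2 * contCount (n + 2) (p + 1) + contCount (n + 1) (p + 3) + contCount n (p + 2) := by
  have hS : ∀ p, ∑ i ∈ Finset.range (p + 1),
      (contCount (n + 1) (p + 1 - i) + i * contCount n (p + 1 - i + 1)) =
      ∑ i ∈ Finset.range p, (contCount (n + 1) (p - i) + i * contCount n (p - i + 1)) +
        ∑ i ∈ Finset.range p, contCount n (p - i + 1) + contCount (n + 1) (p + 1) := by
    intro p
    rw [Finset.sum_range_succ', ← Finset.sum_add_distrib]
    simp only [Nat.add_sub_add_right, Nat.sub_zero, zero_mul, add_zero]
    congr 1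
    exact Finset.sum_congr rfl fun i _ => by ring
  have hT : ∑ i ∈ Finset.range (p + 1), contCount n (p + 1 - i + 1) =
      ∑ i ∈ Finset.range p, contCount n (p - i + 1) + contCount n (p + 2) := by
    rw [Finset.sum_range_succ']
    simp only [Nat.add_sub_add_right, Nat.sub_zero]
  simp only [contCount]
  rw [hS (p + 1), hS p, hT]
  ring

/-! ### Power series -/

open PowerSeries in
theorem eq_of_forall_X_pow_dvd_sub {R : Type*} [CommRing R] {x y : PowerSeries R}
    (h : ∀ n, (X : PowerSeries R) ^ n ∣ x - y) : x = y := by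
  rw [← sub_eq_zero]
  ext n
  simpa using X_pow_dvd_iff.1 (h (n + 1)) n (Nat.lt_succ_self n)

-- Banach's fixed point theorem for the `X`-adic metric: the iterates from `0` converge
-- coefficientwise.
open PowerSeries in
theorem existsUnique_fixedPoint_of_X_pow_dvd {R : Type*} [CommRing R]
    (f : PowerSeries R → PowerSeries R)
    (hf : ∀ x y n, (X : PowerSeries R) ^ n ∣ x - y → X ^ (n + 1) ∣ f x - f y) :
    ∃ x, f x = x ∧ ∀ y, f y = y → y = x := by
  have hu : ∀ n, (X : PowerSeries R) ^ n ∣ f^[n + 1] 0 - f^[n] 0 := by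
    intro n
    induction n with
    | zero => simp
    | succ n ih =>
      rw [Function.iterate_succ_apply' f (n + 1), Function.iterate_succ_apply' f n]
      exact hf _ _ _ (by rwa [← Function.iterate_succ_apply' f n])
  have hu' : ∀ m k, (X : PowerSeries R) ^ m ∣ f^[m + k] 0 - f^[m] 0 := by
    intro m k
    induction k with
    | zero => simp
    | succ k ih =>
      have := dvd_add ((pow_dvd_pow X (Nat.le_add_right m k)).trans (hu (m + k))) ih
      rwa [sub_add_sub_cancel] at this
  let x : PowerSeries R := PowerSeries.mk fun n => coeff n (f^[n + 1] 0)
  have hx : ∀ n, (X : PowerSeries R) ^ n ∣ x - f^[n] 0 := by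
    intro n
    rw [X_pow_dvd_iff]
    intro m hm
    obtain ⟨k, rfl⟩ := Nat.exists_eq_add_of_lt hm
    have := X_pow_dvd_iff.1 (hu' (m + 1) k) m (Nat.lt_succ_self m)
    rw [map_sub, sub_eq_zero] at this
    rw [map_sub, coeff_mk, ← this, show m + 1 + k = m + k + 1 by ring, sub_self]
  have hfix : f x = x := eq_of_forall_X_pow_dvd_sub fun n => by
    have h1 := hf _ _ _ (hx n)
    rw [← Function.iterate_succ_apply' f n] at h1
    have := dvd_sub h1 (hx (n + 1))
    rw [sub_sub_sub_cancel_right] at this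
    exact (pow_dvd_pow X n.le_succ).trans this
  refine ⟨x, hfix, fun y hy => eq_of_forall_X_pow_dvd_sub fun n => ?_⟩
  induction n with
  | zero => simp
  | succ n ih => simpa only [hfix, hy] using hf _ _ _ ih

-- Solved for its bare term `x`, the kernel equation is a fixed point equation in which every other
-- `x` carries a factor `z`, hence a contraction.
open PowerSeries in
theorem existsUnique_kernel663A_eq_zero (K : Type*) [CommRing K] :
    ∃ x : PowerSeries K, kernel663A x = 0 ∧ ∀ y : PowerSeries K, kernel663A y = 0 → y = x := by
  let f : PowerSeries K → PowerSeries K := fun x =>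
    1 - X * x + 2 * X * x ^ 2 + X ^ 2 * x - X ^ 2 * x ^ 3
  have hker : ∀ x, kernel663A x = 0 ↔ f x = x := fun x => by
    rw [← sub_eq_zero (a := f x)]
    simp only [kernel663A, f]
    ring_nf
  simp only [hker]
  refine existsUnique_fixedPoint_of_X_pow_dvd f ?_
  rintro x y n ⟨c, hc⟩
  refine ⟨c * (-1 + 2 * (x + y) + X - X * (x ^ 2 + x * y + y ^ 2)), ?_⟩
  simp only [f]
  linear_combination X * (-1 + 2 * (x + y) + X - X * (x ^ 2 + x * y + y ^ 2)) * hc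

/-! ### Solving the recurrence by means of the kernel -/

section

open PowerSeries

variable {K : Type*} [Field K]

/-- The equations determine all coefficients, by induction on `n` and then on `p`, since terms with
index above `p + 1` on the right carry a factor `z`. The recurrence reaches two steps back in `n`;
the claim about `X * C p` supplies the second step and matches `contCount 0 = 0`. -/
theorem coeff_eq_contCount {C : ℕ → PowerSeries K} (h0 : C 0 = 1 + X * C 1)
    (h1 : C 1 = C 0 + X * C 2)
    (h : ∀ p, C (p + 2) = 2 * C (p + 1) - C p + X * (C (p + 3) - C (p + 2) + X * C (p + 2)))
    (n : ℕ) : (∀ p, coeff n (C p) = (contCount (n + 1) p : K)) ∧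
      ∀ p, coeff n (X * C p) = (contCount n p : K) := by
  induction n with
  | zero =>
    have key : ∀ p, coeff 0 (C p) = 1 ∧ coeff 0 (C (p + 1)) = (1 : K) := by
      intro p
      induction p with
      | zero =>
        have : coeff 0 (C 0) = (1 : K) := by rw [h0]; simp
        refine ⟨this, ?_⟩
        rw [h1, map_add, this]
        simp
      | succ p ih =>
        refine ⟨ih.2, ?_⟩
        rw [h p, map_add, map_sub, two_mul, map_add, ih.1, ih.2]
        simp
    exact ⟨fun p => by simp [(key p).1, contCount], fun p => by simp [contCount]⟩
  | succ n ih =>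
    obtain ⟨ih, ih'⟩ := ih
    have key : ∀ p, coeff (n + 1) (C p) = (contCount (n + 2) p : K) ∧
        coeff (n + 1) (C (p + 1)) = (contCount (n + 2) (p + 1) : K) := by
      intro p
      induction p with
      | zero =>
        have : coeff (n + 1) (C 0) = (contCount (n + 2) 0 : K) := by
          rw [h0, map_add, coeff_succ_X_mul, ih, contCount_zero_right]
          simp [coeff_one]
        refine ⟨this, ?_⟩
        rw [h1, map_add, this, coeff_succ_X_mul, ih, contCount_one_right]
        simp
      | succ p ihp =>
        refine ⟨ihp.2, ?_⟩
        rw [h p, map_add, map_sub, two_mul, map_add, ihp.1, ihp.2, coeff_succ_X_mul, map_add,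
          map_sub, ih, ih, ih']
        have := congrArg (Nat.cast : ℕ → K) (contCount_recurrence n p)
        push_cast at this
        linear_combination -this
    exact ⟨fun p => (key p).1, fun p => by rw [coeff_succ_X_mul, ih]⟩

/-- The sequence with `C (p + 2) = (2 t - z t²) C (p + 1) - t C p` and initial values
`(1 - z t) d` and `d`. -/
noncomputable def kernelSeq (t d : PowerSeries K) : ℕ → PowerSeries K
  | 0 => (1 - X * t) * d
  | 1 => d
  | p + 2 => (2 * t - X * t ^ 2) * kernelSeq t d (p + 1) - t * kernelSeq t d p

/-- By the kernel equation, `t` times the characteristic cubic `zλ³ - (1 + z - z²)λ² + 2λ - 1` is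
`(λ² - (2t - zt²)λ + t)(ztλ - 1)`. The quadratic factor is the recurrence of `kernelSeq`; the two
boundary equations fix its initial values, with `d = 1/(1 - zt - z)`. -/
theorem genFun663A_mul_eq {t : PowerSeries K} (ht : kernel663A t = 0) :
    genFun663A K * (1 - X * t - X) = 1 - X * t := by
  have hunit : (1 - X * t - X) * (1 - X * t - X)⁻¹ = 1 :=
    PowerSeries.mul_inv_cancel _ (by simp)
  set d := (1 - X * t - X)⁻¹
  simp only [kernel663A] at ht
  have ht0 : t ≠ 0 := by
    rintro rfl
    simp at ht
  have hrec : ∀ p, kernelSeq t d (p + 2) =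
      (2 * t - X * t ^ 2) * kernelSeq t d (p + 1) - t * kernelSeq t d p := fun p => rfl
  have key := coeff_eq_contCount (C := kernelSeq t d) (by
      simp only [kernelSeq]
      linear_combination hunit) (by
      simp only [kernelSeq]
      ring) (by
      intro p
      -- The factor `t` clears the denominator of the discarded root `1/(zt)`.
      refine mul_left_cancel₀ ht0 ?_
      have h2 := hrec p
      have h3 := hrec (p + 1)
      linear_combination (-X * t) * h3 + h2 - kernelSeq t d (p + 2) * ht)
  have hA : genFun663A K = (1 - X * t) * d := by
    ext n
    rw [genFun663A, coeff_mk, ncard_class663A_eq_contCount, ← (key n).1]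
    rfl
  rw [hA]
  linear_combination (1 - X * t) * hunit

theorem genFun663A_mul_X_mul {t : PowerSeries K} (ht : kernel663A t = 0) :
    genFun663A K * (X * t) = (t - 1) * (1 - X * t + X ^ 2 * t) := by
  have hA := genFun663A_mul_eq ht
  have hne : (1 - X * t - X : PowerSeries K) ≠ 0 := fun h => by
    simpa using congrArg constantCoeff h
  simp only [kernel663A] at ht
  refine mul_right_cancel₀ hne ?_
  linear_combination X * t * hA + ((1 - X * t) * t - (t - 1) * (1 - X * t - X)) * ht

/-- The series is a Möbius function of `t`; substituting it and multiplying by `D ^ 3` turns the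
cubic into `-z²` times the kernel. -/
theorem genFun663A_cubic :
    1 - (4 - X) * genFun663A K + 2 * (2 - X) * genFun663A K ^ 2 - genFun663A K ^ 3 = 0 := by
  obtain ⟨t, ht, -⟩ := existsUnique_kernel663A_eq_zero K
  have hA := genFun663A_mul_eq ht
  have hne : (1 - X * t - X : PowerSeries K) ≠ 0 := fun h => by
    simpa using congrArg constantCoeff h
  simp only [kernel663A] at ht
  refine (mul_eq_zero.1 ?_).resolve_right (pow_ne_zero 3 hne)
  set D := (1 - X * t - X : PowerSeries K) with hD
  set A := genFun663A K
  set W := (1 - X * t : PowerSeries K) with hW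
  have e : (1 - (4 - X) * A + 2 * (2 - X) * A ^ 2 - A ^ 3) * D ^ 3 =
      D ^ 3 - (4 - X) * (A * D) * D ^ 2 + 2 * (2 - X) * (A * D) ^ 2 * D - (A * D) ^ 3 := by ring
  rw [e, hA, hD, hW]
  linear_combination -X ^ 2 * ht

end

/-! ### The minimal polynomial -/

section

open Polynomial

variable (K : Type*) [Field K]

theorem neg_cubic663A_eq_map :
    -cubic663A K = (X ^ 3 - C (2 * (2 - X)) * X ^ 2 + C (4 - X) * X - 1 : K[X][X]).map
      (algebraMap K[X] (RatFunc K)) := by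
  have h2 : algebraMap K[X] (RatFunc K) 2 = 2 := map_ofNat _ 2
  have h4 : algebraMap K[X] (RatFunc K) 4 = 4 := map_ofNat _ 4
  simp [cubic663A, h2, h4]
  ring

theorem cubic_monic_natDegree {R : Type*} [CommRing R] [Nontrivial R] (a b : R) :
    (X ^ 3 - C a * X ^ 2 + C b * X - 1 : R[X]).Monic ∧
      (X ^ 3 - C a * X ^ 2 + C b * X - 1 : R[X]).natDegree = 3 :=
  ⟨by monicity!, by compute_degree!⟩

theorem neg_cubic663A_natDegree : (-cubic663A K).natDegree = 3 := by
  rw [neg_cubic663A_eq_map, (cubic_monic_natDegree _ _).1.natDegree_map]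
  exact (cubic_monic_natDegree _ _).2

theorem neg_cubic663A_monic : (-cubic663A K).Monic := by
  rw [neg_cubic663A_eq_map]
  exact (cubic_monic_natDegree _ _).1.map _

/-- A cubic without roots is irreducible. A root in `K(z)` is integral over `K[z]`, hence a
polynomial; it divides the constant term `-1`, so it is a constant. -/
theorem neg_cubic663A_irreducible [CharZero K] : Irreducible (-cubic663A K) := by
  have hdeg := neg_cubic663A_natDegree K
  rw [Polynomial.irreducible_iff_roots_eq_zero_of_degree_le_three (by omega) (by omega),
    Multiset.eq_zero_iff_forall_notMem]
  intro r hr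
  have hr0 := (mem_roots'.1 hr).2
  rw [neg_cubic663A_eq_map, IsRoot.def, eval_map_algebraMap] at hr0
  obtain ⟨p, rfl⟩ := isInteger_of_is_root_of_monic (cubic_monic_natDegree _ _).1 hr0
  rw [aeval_algebraMap_apply, map_eq_zero_iff _ (IsFractionRing.injective K[X] (RatFunc K))]
    at hr0
  have hp : p ^ 3 - 2 * (2 - X) * p ^ 2 + (4 - X) * p - 1 = 0 := by
    simpa using hr0
  have hunit : IsUnit p := IsUnit.of_mul_eq_one (p ^ 2 - 2 * (2 - X) * p + (4 - X))
    (by linear_combination hp)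
  obtain ⟨c, -, rfl⟩ := Polynomial.isUnit_iff.1 hunit
  have h0 := congrArg (eval 0) hp
  have h1 := congrArg (eval 1) hp
  simp at h0 h1
  have h8 : (1 : K) = 0 := by
    -- This is the coefficient of `z` in the equation for `c`. At `z = 0` the cubic takes the value
    -- `-1` for `c = 0` and `1/8` for `c = 1/2`, so neither is a root.
    have hc : c * (2 * c - 1) = 0 := by linear_combination h1 - h0
    rcases mul_eq_zero.1 hc with hc | hc
    · rw [hc] at h0
      simp at h0
    · linear_combination 8 * h0 - (4 * c ^ 2 - 14 * c + 9) * hc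
  exact one_ne_zero h8

theorem aeval_genFunLaurent663A :
    aeval (genFunLaurent663A K) (-cubic663A K) = 0 := by
  have h := congrArg (fun f : PowerSeries K => (f : LaurentSeries K)) (genFun663A_cubic (K := K))
  have hX : algebraMap (RatFunc K) (LaurentSeries K) RatFunc.X =
      ((PowerSeries.X : PowerSeries K) : LaurentSeries K) := by
    rw [PowerSeries.coe_X]; exact RatFunc.coe_X
  have e2 : algebraMap (RatFunc K) (LaurentSeries K) 2 = 2 := map_ofNat _ 2
  have e4 : algebraMap (RatFunc K) (LaurentSeries K) 4 = 4 := map_ofNat _ 4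
  have e2' : HahnSeries.ofPowerSeries ℤ K 2 = 2 := map_ofNat _ 2
  have e4' : HahnSeries.ofPowerSeries ℤ K 4 = 4 := map_ofNat _ 4
  simp [cubic663A, hX, genFunLaurent663A, e2, e4, e2', e4'] at h ⊢
  linear_combination -h

end

theorem mainTheorem4 (K : Type*) [Field K] [CharZero K] :
    -- the triple of relations and the set of patterns define the same class
    (∀ n : ℕ, class663A n = patternAvoiders patterns663A n) ∧
    -- the kernel has exactly one power series root `x`, and the generating function, as a Laurent
    -- series in `z`, is `(x - 1) (1 - z x + z² x) / (z x)`
    (∃ x : PowerSeries K,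
      (kernel663A x = 0 ∧ ∀ y : PowerSeries K, kernel663A y = 0 → y = x) ∧
      genFunLaurent663A K =
        (((x - 1) * (1 - PowerSeries.X * x + PowerSeries.X ^ 2 * x) : PowerSeries K) :
            LaurentSeries K) /
          ((PowerSeries.X * x : PowerSeries K) : LaurentSeries K)) ∧
    -- the first terms
    (∀ n : Fin 9, PowerSeries.coeff (n : ℕ) (genFun663A K) =
      (![1, 1, 2, 5, 15, 50, 178, 663, 2552] : Fin 9 → K) n) ∧
    -- algebraic of degree 3; the minimal polynomial is the given cubic, made monic by a sign
    IsAlgebraic (RatFunc K) (genFunLaurent663A K) ∧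
    (minpoly (RatFunc K) (genFunLaurent663A K)).natDegree = 3 ∧
    minpoly (RatFunc K) (genFunLaurent663A K) = -cubic663A K := by
  have hmin : minpoly (RatFunc K) (genFunLaurent663A K) = -cubic663A K :=
    (minpoly.eq_of_irreducible_of_monic (neg_cubic663A_irreducible K)
      (aeval_genFunLaurent663A K) (neg_cubic663A_monic K)).symm
  refine ⟨class663A_eq_patternAvoiders, ?_, ?_, ?_, ?_, hmin⟩
  · obtain ⟨x, hx, hx'⟩ := existsUnique_kernel663A_eq_zero K
    refine ⟨x, ⟨hx, hx'⟩, ?_⟩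
    have hx0 : x ≠ 0 := by
      rintro rfl
      simp [kernel663A] at hx
    have hne : ((PowerSeries.X * x : PowerSeries K) : LaurentSeries K) ≠ 0 := by
      rw [Ne, HahnSeries.ofPowerSeries_injective.eq_iff' (map_zero _)]
      exact mul_ne_zero PowerSeries.X_ne_zero hx0
    rw [eq_div_iff hne, genFunLaurent663A, ← genFun663A_mul_X_mul hx]
    exact (map_mul _ _ _).symm
  · have h : ∀ n, PowerSeries.coeff n (genFun663A K) = (contCount (n + 1) 0 : K) := fun n => by
      rw [genFun663A, PowerSeries.coeff_mk, ncard_class663A_eq_contCount]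
    have hc : ∀ n : Fin 9, contCount (n + 1) 0 =
        (![1, 1, 2, 5, 15, 50, 178, 663, 2552] : Fin 9 → ℕ) n := fun n => by
      fin_cases n <;> rfl
    intro n
    rw [h, hc]
    fin_cases n <;> simp
  · exact ⟨_, (neg_cubic663A_monic K).ne_zero, aeval_genFunLaurent663A K⟩
  · rw [hmin, neg_cubic663A_natDegree]
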